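/- **Lemma (convergence of Q-learning with the smoothed Bellman operator).** Consider a discounted Markov decision process with a finite or countable state space $S$, a finite action set $A$, transition probabilities $P(\cdot\mid s,a)$, a reward function $r:S\times A\to\mathbb R$ with $|r|\le R_{\max}$, and a discount factor $\gamma\in(0,1)$. Let $$Q^*(s,a)=\sup_\pi Q^\pi(s,a),\qquad Q^\pi(s,a)=\sum_{t\ge 0}\gamma^t\,\mathbb E_\pi\big[r(s_t,a_t)\mid s_0=s,\ a_0=a\big],$$ where the supremum is over all (randomized, possibly history-dependent) policies. On a probability space with a filtration $(\mathcal F_t)_{t\ge0}$, let $(s_t,a_t)$ be $\mathcal F_t$-measurable states and actions and $r_t$ be $\mathcal F_{t+1}$-measurable observed rewards such that almost surely, for all $t$ and $s'$, $$\mathbb P(s_{t+1}=s'\mid\mathcal F_t)=P(s'\mid s_t,a_t),\qquad \mathbb E[r_t\mid\mathcal F_t]=r(s_t,a_t),\qquad |r_t|\le R_{\max}.$$ For every $t$ and $s$ let $q_t(\cdot\mid s)$ be an $\mathcal F_{t+1}$-measurable random probability distribution on $A$, and let the step sizes $\alpha_t(s,a)$ be $\mathcal F_t$-measurable. Start from an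 $\mathcal F_0$-measurable, uniformly bounded $Q_0$ and set $$Q_{t+1}(s_t,a_t)=Q_t(s_t,a_t)+\alpha_t(s_t,a_t)\Big(r_t+\gamma\sum_{a\in A}q_t(a\mid s_{t+1})\,Q_t(s_{t+1},a)-Q_t(s_t,a_t)\Big),$$ and $Q_{t+1}(s,a)=Q_t(s,a)$ for $(s,a)\ne(s_t,a_t)$. Suppose that almost surely 1. (step sizes) $0\le\alpha_t(s_t,a_t)\le1$ for all $t$, and for every $(s,a)\in S\times A$ $$\sum_{t:\,(s_t,a_t)=(s,a)}\alpha_t(s,a)=\infty,\qquad \sum_{t:\,(s_t,a_t)=(s,a)}\alpha_t(s,a)^2<\infty;$$ 2. (asymptotically greedy smoothing) either $\sum_{a\in\arg\max_b Q_t(s_{t+1},b)}q_t(a\mid s_{t+1})\to1$ as $t\to\infty$, or $\sum_{a\in\arg\max_b Q^*(s_{t+1},b)}q_t(a\mid s_{t+1})\to1$ as $t\to\infty$. Then, with probability $1$, $Q_t(s,a)\to Q^*(s,a)$ as $t\to\infty$ for every $(s,a)\in S\times A$. -/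

import Mathlib

open Filter Topology MeasureTheory ProbabilityTheory

noncomputable section

/-- A discounted Markov decision process with state space `S` and action space `A`: the law
`trans s a` of the next state, the (mean) reward `reward s a`, and the discount factor. -/
structure MDP (S A : Type*) where
  trans : S → A → PMF S
  reward : S → A → ℝ
  discount : ℝ
  discount_pos : 0 < discount
  discount_lt_one : discount < 1

/-- A (randomized, history-dependent) control policy: given the list of the earlier state-action
pairs (most recent first) and the current state, a distribution over actions. -/
abbrev Policy (S A : Type*) := List (S × A) → S → PMF A

namespace MDP

variable {S A : Type*} (M : MDP S A)

/-- Joint law at time `t` of the list of the earlier state-action pairs (most recent first) and of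
the current pair `(s_t, a_t)`, when the process starts in `(s_0, a_0) = (s, a)` and all later
actions are drawn from the policy `π`. -/
def historyLaw (π : Policy S A) (s : S) (a : A) : ℕ → PMF (List (S × A) × (S × A))
  | 0 => PMF.pure ([], (s, a))
  | t + 1 => (historyLaw π s a t).bind fun h =>
      (M.trans h.2.1 h.2.2).bind fun s' =>
        (π (h.2 :: h.1) s').bind fun a' => PMF.pure (h.2 :: h.1, (s', a'))

/-- `E_π[r(s_t, a_t) | s_0 = s, a_0 = a]`. -/
def expectedReward (π : Policy S A) (s : S) (a : A) (t : ℕ) : ℝ :=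
  ∑' h : List (S × A) × (S × A), (M.historyLaw π s a t h).toReal * M.reward h.2.1 h.2.2

/-- The action value `Q^π(s, a) = ∑_t γ^t E_π[r(s_t, a_t) | s_0 = s, a_0 = a]`. -/
def actionValue (π : Policy S A) (s : S) (a : A) : ℝ :=
  ∑' t : ℕ, M.discount ^ t * M.expectedReward π s a t

/-- The optimal action value `Q^*(s, a) = sup_π Q^π(s, a)`. -/
def optimalQ (s : S) (a : A) : ℝ := ⨆ π : Policy S A, M.actionValue π s a

end MDP

/-- The smoothed Bellman target `r + γ ∑_a q(a | s') Q(s', a)`. -/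
def smoothedBellman {S A : Type*} [Fintype A] (γ : ℝ) (q Q : S → A → ℝ) (r : ℝ) (s' : S) : ℝ :=
  r + γ * ∑ a, q s' a * Q s' a

/-- The actions that maximize `Q(s, ·)`. -/
def greedyActions {S A : Type*} (Q : S → A → ℝ) (s : S) : Set A := {a | ∀ b, Q s b ≤ Q s a}

/-- The mass `∑_{a ∈ B} p(a)`. -/
def actionMass {A : Type*} [Fintype A] (p : A → ℝ) (B : Set A) : ℝ := ∑ a, B.indicator p a

/-- The step size effectively used at the pair `(s, a)` at time `t`: it is `α_t(s, a)` if
`(s_t, a_t) = (s, a)` and `0` otherwise. -/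
def usedStep {S A : Type*} (st : ℕ → S) (act : ℕ → A) (α : ℕ → S → A → ℝ) (s : S) (a : A)
    (t : ℕ) : ℝ :=
  {k : ℕ | st k = s ∧ act k = a}.indicator (fun k => α k s a) t

end

/-! `M.optimalQ`, written `Q*`, is a bounded fixed point of the Bellman operator
(`optimalQ_bellman`), so at each fixed pair the error `Δ_t = Q_t - Q*` obeys a stochastic
approximation recursion driven by the used steps. With `Y_t(s) = max_b |Δ_t(s, b)|`, the smoothed
average at `s_{t+1}` differs from `max_b Q*(s_{t+1}, b)` by at most `Y_t(s_{t+1}) + ε_t`, where `ε_t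
→ 0` (`exists_smoothing_error`).

The weights `q_t` are only known at time `t + 1`, so this estimate is used along the path, before
any conditioning. Only then are three quantities centred given `ℱ t`: the reward, `max_b Q*(s_{t+1},
b)` and `Y_t(s_{t+1})`. Each centred term is a bounded martingale difference, and its sum weighted
by the square-summable steps converges almost surely (`ae_exists_tendsto_sum_mul`).

The rest is deterministic (`tendsto_optimalQ_of_trajectory`). The remaining drift is `γ (ε_t + E
Y_t(s'))`, with `s'` drawn from the transition law. If `limsup |Δ_t| ≤ c` at every pair, dominated
convergence and the divergence of the step sums give `limsup |Δ_t| ≤ γ c` at every pair. Iterating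
from a uniform bound `D` gives `γ^k D → 0`. The limsups are taken pair by pair, so an infinite state
space causes no loss. -/

noncomputable section

/-! ### Means under a probability mass function, and finite maxima. -/

/-- The mean of `f` under the probability mass function `p`. -/
def PMF.mean {X : Type*} (p : PMF X) (f : X → ℝ) : ℝ := ∑' x, (p x).toReal * f x

namespace PMF

variable {X Y : Type*} (p : PMF X) {f g : X → ℝ} {C : ℝ}

lemma hasSum_toReal : HasSum (fun x => (p x).toReal) 1 := by
  have h := ENNReal.hasSum_toReal (f := p) (by simp [p.tsum_coe])
  rwa [← ENNReal.tsum_toReal_eq (fun x => p.apply_ne_top x), p.tsum_coe, ENNReal.toReal_one] at h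

lemma summable_mul (hf : ∀ x, |f x| ≤ C) : Summable fun x => (p x).toReal * f x := by
  refine Summable.of_norm_bounded (p.hasSum_toReal.summable.mul_right C) fun x => ?_
  rw [Real.norm_eq_abs, abs_mul, abs_of_nonneg ENNReal.toReal_nonneg]
  exact mul_le_mul_of_nonneg_left (hf x) ENNReal.toReal_nonneg

lemma mean_const (c : ℝ) : p.mean (fun _ => c) = c := by
  rw [mean, tsum_mul_right, p.hasSum_toReal.tsum_eq, one_mul]

lemma mean_mono {D : ℝ} (hf : ∀ x, |f x| ≤ C) (hg : ∀ x, |g x| ≤ D) (h : ∀ x, f x ≤ g x) :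
    p.mean f ≤ p.mean g :=
  (p.summable_mul hf).tsum_le_tsum
    (fun x => mul_le_mul_of_nonneg_left (h x) ENNReal.toReal_nonneg) (p.summable_mul hg)

lemma mean_add {D : ℝ} (hf : ∀ x, |f x| ≤ C) (hg : ∀ x, |g x| ≤ D) :
    p.mean (fun x => f x + g x) = p.mean f + p.mean g := by
  simp only [mean, mul_add]
  exact (p.summable_mul hf).tsum_add (p.summable_mul hg)

lemma mean_sub {D : ℝ} (hf : ∀ x, |f x| ≤ C) (hg : ∀ x, |g x| ≤ D) :
    p.mean (fun x => f x - g x) = p.mean f - p.mean g := by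
  simp only [mean, mul_sub]
  exact (p.summable_mul hf).tsum_sub (p.summable_mul hg)

lemma mean_const_mul (c : ℝ) : p.mean (fun x => c * f x) = c * p.mean f := by
  simp only [mean, ← tsum_mul_left]
  exact tsum_congr fun x => by ring

lemma abs_mean_le (hf : ∀ x, |f x| ≤ C) : |p.mean f| ≤ C := by
  have hC : ∀ _ : X, |C| ≤ |C| := fun _ => le_rfl
  have hC' : ∀ _ : X, |-C| ≤ |C| := fun _ => (abs_neg C).le
  refine abs_le.2 ⟨?_, ?_⟩
  · simpa only [mean_const] using p.mean_mono hC' hf fun x => (abs_le.1 (hf x)).1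
  · simpa only [mean_const] using p.mean_mono hf hC fun x => (abs_le.1 (hf x)).2

lemma mean_pure (x : X) (f : X → ℝ) : (PMF.pure x).mean f = f x := by
  classical
  rw [mean, tsum_eq_single x]
  · simp
  · intro y hy
    simp [PMF.pure_apply, hy]

lemma mean_bind (k : X → PMF Y) {f : Y → ℝ} (hf : ∀ y, |f y| ≤ C) :
    (p.bind k).mean f = p.mean fun x => (k x).mean f := by
  have hbind : ∀ y, ((p.bind k) y).toReal = ∑' x, (p x).toReal * (k x y).toReal := fun y => by
    rw [PMF.bind_apply, ENNReal.tsum_toReal_eq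
      (fun x => ENNReal.mul_ne_top (p.apply_ne_top x) ((k x).apply_ne_top y))]
    simp
  have hsum : Summable fun z : X × Y => (p z.1).toReal * (k z.1 z.2).toReal := by
    refine (summable_prod_of_nonneg fun z =>
      mul_nonneg ENNReal.toReal_nonneg ENNReal.toReal_nonneg).2 ⟨fun x => ?_, ?_⟩
    · exact (k x).hasSum_toReal.summable.mul_left (p x).toReal
    · refine p.hasSum_toReal.summable.congr fun x => ?_
      simp only [tsum_mul_left, (k x).hasSum_toReal.tsum_eq, mul_one]
  -- Boundedness of `f` gives absolute summability on `X × Y`, which justifies exchanging the sums.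
  have hsum' : Summable fun z : X × Y => (p z.1).toReal * (k z.1 z.2).toReal * f z.2 := by
    refine Summable.of_norm_bounded (hsum.mul_right C) fun z => ?_
    rw [Real.norm_eq_abs, abs_mul, abs_of_nonneg (mul_nonneg ENNReal.toReal_nonneg ENNReal.toReal_nonneg)]
    exact mul_le_mul_of_nonneg_left (hf z.2)
      (mul_nonneg ENNReal.toReal_nonneg ENNReal.toReal_nonneg)
  calc (p.bind k).mean f = ∑' y, ∑' x, (p x).toReal * (k x y).toReal * f y := by
        simp only [mean, hbind, tsum_mul_right]
    _ = ∑' x, ∑' y, (p x).toReal * (k x y).toReal * f y :=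
        Summable.tsum_comm (f := fun x y => (p x).toReal * (k x y).toReal * f y) hsum'
    _ = _ := by simp only [mean, mul_assoc, tsum_mul_left]

end PMF

lemma abs_ciSup_sub_ciSup_le {A : Type*} [Finite A] [Nonempty A] {f g : A → ℝ} {c : ℝ}
    (h : ∀ a, |f a - g a| ≤ c) : |(⨆ a, f a) - ⨆ a, g a| ≤ c := by
  have hf := Set.finite_range f |>.bddAbove
  have hg := Set.finite_range g |>.bddAbove
  refine abs_sub_le_iff.2 ⟨sub_le_iff_le_add.2 (ciSup_le fun a => ?_),
    sub_le_iff_le_add.2 (ciSup_le fun a => ?_)⟩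
  · linarith [(abs_le.1 (h a)).2, le_ciSup hg a]
  · linarith [(abs_le.1 (h a)).1, le_ciSup hf a]

lemma abs_ciSup_le {A : Type*} [Finite A] [Nonempty A] {f : A → ℝ} {c : ℝ}
    (h : ∀ a, |f a| ≤ c) : |⨆ a, f a| ≤ c := by
  simpa using abs_ciSup_sub_ciSup_le (f := f) (g := fun _ => 0) (by simpa using h)

/-! ### The Bellman equation for the optimal action value. -/

namespace MDP

variable {S A : Type*} (M : MDP S A) {R C : ℝ}

/-- The Bellman optimality operator. -/
def bellman (Q : S → A → ℝ) (s : S) (a : A) : ℝ :=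
  M.reward s a + M.discount * (M.trans s a).mean fun s' => ⨆ b, Q s' b

lemma abs_bellman_le [Finite A] [Nonempty A] (hR : ∀ s a, |M.reward s a| ≤ R) {Q : S → A → ℝ}
    (hQ : ∀ s a, |Q s a| ≤ C) (s : S) (a : A) : |M.bellman Q s a| ≤ R + M.discount * C := by
  refine (abs_add_le _ _).trans (add_le_add (hR s a) ?_)
  rw [abs_mul, abs_of_pos M.discount_pos]
  exact mul_le_mul_of_nonneg_left (PMF.abs_mean_le _ fun s' => abs_ciSup_le (hQ s'))
    M.discount_pos.le

lemma abs_bellman_sub_le [Finite A] [Nonempty A] {Q Q' : S → A → ℝ} {D c : ℝ}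
    (hQ : ∀ s a, |Q s a| ≤ C) (hQ' : ∀ s a, |Q' s a| ≤ D) (h : ∀ s a, |Q s a - Q' s a| ≤ c)
    (s : S) (a : A) : |M.bellman Q s a - M.bellman Q' s a| ≤ M.discount * c := by
  have e : M.bellman Q s a - M.bellman Q' s a
      = M.discount * (M.trans s a).mean fun s' => (⨆ b, Q s' b) - ⨆ b, Q' s' b := by
    rw [PMF.mean_sub _ (fun s' => abs_ciSup_le (hQ s')) (fun s' => abs_ciSup_le (hQ' s'))]
    simp only [bellman]
    ring
  rw [e, abs_mul, abs_of_pos M.discount_pos]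
  exact mul_le_mul_of_nonneg_left
    (PMF.abs_mean_le _ fun s' => abs_ciSup_sub_ciSup_le (h s')) M.discount_pos.le

lemma exists_bounded_fixedPoint [Finite A] [Nonempty A] (hR : ∀ s a, |M.reward s a| ≤ R) :
    ∃ (Q : S → A → ℝ) (C : ℝ), (∀ s a, |Q s a| ≤ C) ∧ ∀ s a, M.bellman Q s a = Q s a := by
  -- With the discrete topology, all bounded functions form a complete metric space, where Banach's
  -- theorem applies.
  let _ : TopologicalSpace (S × A) := ⊥
  have : DiscreteTopology (S × A) := ⟨rfl⟩
  have hb : ∀ (F : BoundedContinuousFunction (S × A) ℝ) s a, |F (s, a)| ≤ ‖F‖ :=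
    fun F s a => F.norm_coe_le_norm (s, a)
  let T : BoundedContinuousFunction (S × A) ℝ → BoundedContinuousFunction (S × A) ℝ := fun F =>
    BoundedContinuousFunction.ofNormedAddCommGroupDiscrete
      (fun x => M.bellman (fun s a => F (s, a)) x.1 x.2) (R + M.discount * ‖F‖)
      (fun x => M.abs_bellman_le hR (hb F) x.1 x.2)
  have hT : ContractingWith ⟨M.discount, M.discount_pos.le⟩ T := by
    refine ⟨by exact_mod_cast M.discount_lt_one, LipschitzWith.of_dist_le_mul fun F G => ?_⟩
    refine (BoundedContinuousFunction.dist_le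
      (mul_nonneg M.discount_pos.le dist_nonneg)).2 fun x => ?_
    exact M.abs_bellman_sub_le (hb F) (hb G)
      (fun s a => (BoundedContinuousFunction.dist_coe_le_dist (f := F) (g := G) (s, a))) x.1 x.2
  let F := hT.fixedPoint T
  refine ⟨fun s a => F (s, a), ‖F‖, hb F, fun s a => ?_⟩
  exact congrArg (fun G : BoundedContinuousFunction (S × A) ℝ => G (s, a)) hT.fixedPoint_isFixedPt

lemma expectedReward_eq_mean (π : Policy S A) (s : S) (a : A) (t : ℕ) :
    M.expectedReward π s a t
      = (M.historyLaw π s a t).mean fun h => M.reward h.2.1 h.2.2 := rfl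

lemma mean_historyLaw_succ (π : Policy S A) (s : S) (a : A) (t : ℕ) {f : S × A → ℝ}
    (hf : ∀ x, |f x| ≤ C) :
    ((M.historyLaw π s a (t + 1)).mean fun h => f h.2)
      = (M.historyLaw π s a t).mean fun h => (M.trans h.2.1 h.2.2).mean fun s' =>
          (π (h.2 :: h.1) s').mean fun a' => f (s', a') := by
  have hf' : ∀ h : List (S × A) × (S × A), |f h.2| ≤ C := fun h => hf h.2
  rw [historyLaw, PMF.mean_bind _ _ hf']
  congr 1
  funext h
  rw [PMF.mean_bind _ _ hf']
  congr 1
  funext s'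
  rw [PMF.mean_bind _ _ hf']
  simp only [PMF.mean_pure]

variable {Q : S → A → ℝ}

/-- Solving the fixed point equation for the reward makes the discounted reward sum telescope, up to
replacing `Q` at the next pair by its maximum over actions. -/
lemma mean_reward_eq [Finite A] [Nonempty A] (hQ : ∀ s a, |Q s a| ≤ C)
    (hfix : ∀ s a, M.bellman Q s a = Q s a) (π : Policy S A) (s : S) (a : A) (t : ℕ) :
    M.expectedReward π s a t = ((M.historyLaw π s a t).mean fun h => Q h.2.1 h.2.2)
      - M.discount * (M.historyLaw π s a t).mean fun h =>
          (M.trans h.2.1 h.2.2).mean fun s' => ⨆ b, Q s' b := by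
  have hV : ∀ h : List (S × A) × (S × A),
      |(M.trans h.2.1 h.2.2).mean fun s' => ⨆ b, Q s' b| ≤ C :=
    fun h => PMF.abs_mean_le _ fun s' => abs_ciSup_le (hQ s')
  have hV' : ∀ h : List (S × A) × (S × A),
      |M.discount * (M.trans h.2.1 h.2.2).mean fun s' => ⨆ b, Q s' b| ≤ M.discount * C :=
    fun h => by
      rw [abs_mul, abs_of_pos M.discount_pos]
      exact mul_le_mul_of_nonneg_left (hV h) M.discount_pos.le
  rw [← PMF.mean_const_mul,
    ← PMF.mean_sub _ (fun h : List (S × A) × (S × A) => hQ h.2.1 h.2.2) hV',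
    expectedReward_eq_mean]
  congr 1
  funext h
  rw [← hfix h.2.1 h.2.2, bellman]
  ring

lemma abs_expectedReward_le (hR : ∀ s a, |M.reward s a| ≤ R) (π : Policy S A) (s : S) (a : A)
    (t : ℕ) : |M.expectedReward π s a t| ≤ R :=
  PMF.abs_mean_le _ fun h => hR h.2.1 h.2.2

lemma hasSum_actionValue (hR : ∀ s a, |M.reward s a| ≤ R) (π : Policy S A) (s : S) (a : A) :
    HasSum (fun t => M.discount ^ t * M.expectedReward π s a t) (M.actionValue π s a) := by
  refine Summable.hasSum (Summable.of_norm_bounded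
    ((summable_geometric_of_lt_one M.discount_pos.le M.discount_lt_one).mul_right R) fun t => ?_)
  have := pow_pos M.discount_pos t
  rw [Real.norm_eq_abs, abs_mul, abs_of_pos this]
  exact mul_le_mul_of_nonneg_left (M.abs_expectedReward_le hR π s a t) this.le

lemma tendsto_telescope (hQ : ∀ s a, |Q s a| ≤ C) (π : Policy S A) (s : S) (a : A) :
    Tendsto (fun n => Q s a
      - M.discount ^ n * (M.historyLaw π s a n).mean fun h => Q h.2.1 h.2.2) atTop
      (𝓝 (Q s a)) := by
  have h0 : Tendsto (fun n => M.discount ^ n *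
      (M.historyLaw π s a n).mean fun h => Q h.2.1 h.2.2) atTop (𝓝 0) := by
    refine squeeze_zero_norm (a := fun n => M.discount ^ n * C) (fun n => ?_) ?_
    · have := pow_pos M.discount_pos n
      rw [Real.norm_eq_abs, abs_mul, abs_of_pos this]
      exact mul_le_mul_of_nonneg_left
        (PMF.abs_mean_le _ fun h : List (S × A) × (S × A) => hQ h.2.1 h.2.2) this.le
    · simpa using (tendsto_pow_atTop_nhds_zero_of_lt_one M.discount_pos.le
        M.discount_lt_one).mul_const C
  simpa using tendsto_const_nhds.sub h0

/-- By induction, `n` steps of discounted reward are at most `Q s a - γ^n E[Q(s_n, a_n)]`: whatever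
the history, the mean of `Q` over the policy's action is at most its maximum. The remainder vanishes
by `tendsto_telescope`. -/
lemma actionValue_le [Finite A] [Nonempty A] (hR : ∀ s a, |M.reward s a| ≤ R) (hQ : ∀ s a, |Q s a| ≤ C)
    (hfix : ∀ s a, M.bellman Q s a = Q s a) (π : Policy S A) (s : S) (a : A) :
    M.actionValue π s a ≤ Q s a := by
  refine le_of_tendsto_of_tendsto' (M.hasSum_actionValue hR π s a).tendsto_sum_nat
    (M.tendsto_telescope hQ π s a) fun n => ?_
  induction n with
  | zero => simp [historyLaw, PMF.mean_pure]
  | succ n ih =>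
    have hle : ((M.historyLaw π s a (n + 1)).mean fun h => Q h.2.1 h.2.2)
        ≤ (M.historyLaw π s a n).mean fun h =>
          (M.trans h.2.1 h.2.2).mean fun s' => ⨆ b, Q s' b := by
      rw [M.mean_historyLaw_succ π s a n (f := fun x => Q x.1 x.2) (fun x => hQ x.1 x.2)]
      have hA : ∀ (h : List (S × A) × (S × A)) s',
          |(π (h.2 :: h.1) s').mean fun a' => Q s' a'| ≤ C :=
        fun h s' => PMF.abs_mean_le _ (hQ s')
      refine PMF.mean_mono _ (fun h => PMF.abs_mean_le _ (hA h))
        (fun h => PMF.abs_mean_le _ fun s' => abs_ciSup_le (hQ s')) fun h => ?_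
      refine PMF.mean_mono _ (hA h) (fun s' => abs_ciSup_le (hQ s')) fun s' => ?_
      rw [← PMF.mean_const (π (h.2 :: h.1) s') (⨆ b, Q s' b)]
      exact PMF.mean_mono _ (hQ s') (fun _ => le_rfl)
        fun b => le_ciSup (Set.finite_range (Q s')).bddAbove b
    rw [Finset.sum_range_succ, M.mean_reward_eq hQ hfix]
    have := mul_le_mul_of_nonneg_left hle (pow_pos M.discount_pos (n + 1)).le
    rw [pow_succ] at this ⊢
    linarith

/-- A greedy action attains the maximum, so the telescoping inequality of `actionValue_le` becomes
an equality. -/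
lemma actionValue_greedy [Finite A] [Nonempty A] (hR : ∀ s a, |M.reward s a| ≤ R) (hQ : ∀ s a, |Q s a| ≤ C)
    (hfix : ∀ s a, M.bellman Q s a = Q s a) {φ : S → A} (hφ : ∀ s, Q s (φ s) = ⨆ b, Q s b)
    (s : S) (a : A) : M.actionValue (fun _ s => PMF.pure (φ s)) s a = Q s a := by
  set π : Policy S A := fun _ s => PMF.pure (φ s)
  refine tendsto_nhds_unique (M.hasSum_actionValue hR π s a).tendsto_sum_nat
    ((M.tendsto_telescope hQ π s a).congr fun n => ?_)
  induction n with
  | zero => simp [historyLaw, PMF.mean_pure]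
  | succ n ih =>
    have hle : ((M.historyLaw π s a (n + 1)).mean fun h => Q h.2.1 h.2.2)
        = (M.historyLaw π s a n).mean fun h =>
          (M.trans h.2.1 h.2.2).mean fun s' => ⨆ b, Q s' b := by
      rw [M.mean_historyLaw_succ π s a n (f := fun x => Q x.1 x.2) (fun x => hQ x.1 x.2)]
      simp only [π, PMF.mean_pure, hφ]
    rw [Finset.sum_range_succ, M.mean_reward_eq hQ hfix, ← ih, hle]
    ring

/-- The optimal action value is bounded and solves the Bellman optimality equation. -/
theorem optimalQ_bellman [Finite A] [Nonempty A] (hR : ∀ s a, |M.reward s a| ≤ R) :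
    ∃ C : ℝ, (∀ s a, |M.optimalQ s a| ≤ C) ∧
      ∀ s a, M.bellman M.optimalQ s a = M.optimalQ s a := by
  obtain ⟨Q, C, hQ, hfix⟩ := M.exists_bounded_fixedPoint hR
  have hex : ∀ s, ∃ b, Q s b = ⨆ b, Q s b := fun s => exists_eq_ciSup_of_finite
  choose φ hφ using hex
  have e : M.optimalQ = Q := by
    funext s a
    refine le_antisymm ?_ ?_
    · have : Nonempty (Policy S A) := ⟨fun _ s => PMF.pure (φ s)⟩
      exact ciSup_le fun π => M.actionValue_le hR hQ hfix π s a
    · rw [← M.actionValue_greedy hR hQ hfix hφ s a]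
      refine le_ciSup (f := fun π : Policy S A => M.actionValue π s a) ⟨Q s a, ?_⟩ _
      rintro _ ⟨π, rfl⟩
      exact M.actionValue_le hR hQ hfix π s a
  exact ⟨C, e ▸ hQ, e ▸ hfix⟩

end MDP

/-! ### Deterministic stochastic approximation recursions. -/

/-- Once `y t ≤ c + δ / 2`, each step multiplies the bound on the excess of `v` over that level by
`1 - a t ≤ exp (-a t)`; the divergent sum of steps drives it to zero. -/
lemma eventually_le_of_recursion {a v y : ℕ → ℝ} {c : ℝ} (ha : ∀ t, a t ∈ Set.Icc (0 : ℝ) 1)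
    (hsum : Tendsto (fun n => ∑ t ∈ Finset.range n, a t) atTop atTop)
    (hv : ∀ t, v (t + 1) ≤ (1 - a t) * v t + a t * y t)
    (hy : ∀ δ > 0, ∀ᶠ t in atTop, y t ≤ c + δ) : ∀ δ > 0, ∀ᶠ t in atTop, v t ≤ c + δ := by
  intro δ hδ
  obtain ⟨T, hT⟩ := eventually_atTop.1 (hy (δ / 2) (half_pos hδ))
  -- The absolute value keeps the right side nonnegative, so replacing `1 - a n` by the larger
  -- exponential preserves the inequality.
  have hle : ∀ n ≥ T, v n - (c + δ / 2) ≤ |v T - (c + δ / 2)| *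
      Real.exp ((∑ t ∈ Finset.range T, a t) - ∑ t ∈ Finset.range n, a t) := by
    intro n hn
    induction n, hn using Nat.le_induction with
    | base =>
      rw [sub_self, Real.exp_zero, mul_one]
      exact le_abs_self _
    | succ n hn ih =>
      have h1 : 1 - a n ≤ Real.exp (-a n) := by linarith [Real.add_one_le_exp (-a n)]
      have h2 := (ha n).1
      have h3 := (ha n).2
      calc v (n + 1) - (c + δ / 2) ≤ (1 - a n) * (v n - (c + δ / 2)) := by
            linarith [hv n, mul_le_mul_of_nonneg_left (hT n hn) h2]
        _ ≤ (1 - a n) * (|v T - (c + δ / 2)| *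
              Real.exp ((∑ t ∈ Finset.range T, a t) - ∑ t ∈ Finset.range n, a t)) :=
            mul_le_mul_of_nonneg_left ih (by linarith)
        _ ≤ Real.exp (-a n) * (|v T - (c + δ / 2)| *
              Real.exp ((∑ t ∈ Finset.range T, a t) - ∑ t ∈ Finset.range n, a t)) :=
            mul_le_mul_of_nonneg_right h1 (by positivity)
        _ = _ := by
            rw [Finset.sum_range_succ, sub_add_eq_sub_sub (∑ t ∈ Finset.range T, a t),
              sub_eq_add_neg _ (a n), Real.exp_add]
            ring
  have hlim : Tendsto (fun n => |v T - (c + δ / 2)| *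
      Real.exp ((∑ t ∈ Finset.range T, a t) - ∑ t ∈ Finset.range n, a t)) atTop (𝓝 0) := by
    have h := (Real.tendsto_exp_atBot.comp (tendsto_atBot_add_const_left _
      (∑ t ∈ Finset.range T, a t) (tendsto_neg_atTop_atBot.comp hsum))).const_mul
        |v T - (c + δ / 2)|
    simpa [Function.comp_def, sub_eq_add_neg] using h
  filter_upwards [eventually_ge_atTop T, hlim.eventually_le_const (half_pos hδ)] with n hn hn'
  linarith [hle n hn]

lemma eventually_le_of_noisy_recursion {a v y w : ℕ → ℝ} {c l : ℝ}
    (ha : ∀ t, a t ∈ Set.Icc (0 : ℝ) 1)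
    (hsum : Tendsto (fun n => ∑ t ∈ Finset.range n, a t) atTop atTop)
    (hw : Tendsto (fun n => ∑ t ∈ Finset.range n, a t * w t) atTop (𝓝 l))
    (hv : ∀ t, v (t + 1) ≤ (1 - a t) * v t + a t * (w t + y t))
    (hy : ∀ δ > 0, ∀ᶠ t in atTop, y t ≤ c + δ) : ∀ δ > 0, ∀ᶠ t in atTop, v t ≤ c + δ := by
  -- `N` is the tail of the convergent noise series. Adding it to `v` absorbs the noise: `v + N`
  -- satisfies the noiseless recursion with `y + N` in place of `y`.
  set N : ℕ → ℝ := fun n => l - ∑ t ∈ Finset.range n, a t * w t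
  have hN : Tendsto N atTop (𝓝 0) := by simpa using hw.const_sub l
  have hN' : ∀ δ > 0, ∀ᶠ t in atTop, |N t| < δ := fun δ hδ => by
    simpa using hN.eventually (Metric.ball_mem_nhds 0 hδ)
  have key := eventually_le_of_recursion (v := fun t => v t + N t) (y := fun t => y t + N t)
    (c := c) ha hsum (fun t => by
      simp only [N, Finset.sum_range_succ]
      linarith [hv t])
    fun δ hδ => by
      filter_upwards [hy (δ / 2) (half_pos hδ), hN' _ (half_pos hδ)] with t h1 h2
      linarith [le_abs_self (N t)]
  intro δ hδ
  filter_upwards [key (δ / 2) (half_pos hδ), hN' _ (half_pos hδ)] with t h1 h2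
  linarith [neg_abs_le (N t)]

/-! ### Conditional laws and martingale transforms. -/

section Probability

variable {Ω : Type*}

lemma measurable_mean {S : Type*} [Countable S] {_ : MeasurableSpace Ω} {p : Ω → PMF S}
    (hp : ∀ s, Measurable fun ω => (p ω s).toReal) {g : Ω → S → ℝ}
    (hg : ∀ s, Measurable fun ω => g ω s) : Measurable fun ω => (p ω).mean (g ω) :=
  Measurable.tsum fun s => (hp s).mul (hg s)

/-- The conditional mean of `g(X)` given `m`, for `m`-measurable `g` and `X` with conditional
law `p`. -/
theorem condExp_comp_eq_mean {S : Type*} [Countable S] [MeasurableSpace S]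
    [MeasurableSingletonClass S] {m mΩ : MeasurableSpace Ω} {μ : Measure Ω}
    [IsProbabilityMeasure μ] (hm : m ≤ mΩ) {X : Ω → S}
    (hX : Measurable X) {p : Ω → PMF S} (hp : ∀ s, μ⟦X ⁻¹' {s} | m⟧ =ᵐ[μ] fun ω => (p ω s).toReal)
    (hpm : ∀ s, Measurable[m] fun ω => (p ω s).toReal) {g : Ω → S → ℝ} {C : ℝ}
    (hg : ∀ s, Measurable[m] fun ω => g ω s) (hgC : ∀ ω s, |g ω s| ≤ C) :
    μ[fun ω => g ω (X ω) | m] =ᵐ[μ] fun ω => (p ω).mean (g ω) := by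
  classical
  have hgX : Measurable fun ω => g ω (X ω) := by
    have : Measurable fun z : Ω × S => g z.1 z.2 :=
      measurable_from_prod_countable_left fun s => (hg s).mono hm le_rfl
    exact this.comp (measurable_id.prodMk hX)
  have hint : Integrable (fun ω => g ω (X ω)) μ :=
    Integrable.of_bound hgX.aestronglyMeasurable C (ae_of_all _ fun ω => hgC ω (X ω))
  have hmean : Measurable[m] fun ω => (p ω).mean (g ω) :=
    measurable_mean hpm hg
  have hmint : Integrable (fun ω => (p ω).mean (g ω)) μ :=
    Integrable.of_bound (hmean.mono hm le_rfl).aestronglyMeasurable C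
      (ae_of_all _ fun ω => (p ω).abs_mean_le (hgC ω))
  refine (ae_eq_condExp_of_forall_setIntegral_eq hm hint (fun _ _ _ => hmint.integrableOn)
    (fun B hB _ => ?_) hmean.stronglyMeasurable.aestronglyMeasurable).symm
  have hXs : ∀ s, MeasurableSet (X ⁻¹' {s}) := fun s => hX (measurableSet_singleton s)
  have h1 : HasSum (fun s => ∫ ω in B, (p ω s).toReal * g ω s ∂μ)
      (∫ ω in B, (p ω).mean (g ω) ∂μ) := by
    refine hasSum_integral_of_dominated_convergence (fun s ω => (p ω s).toReal * C)
      (fun s => (((hpm s).mul (hg s)).mono hm le_rfl).aestronglyMeasurable)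
      (fun s => ae_of_all _ fun ω => ?_)
      (ae_of_all _ fun ω => (p ω).hasSum_toReal.summable.mul_right C) ?_
      (ae_of_all _ fun ω => ((p ω).summable_mul (hgC ω)).hasSum)
    · rw [Real.norm_eq_abs, abs_mul, abs_of_nonneg ENNReal.toReal_nonneg]
      exact mul_le_mul_of_nonneg_left (hgC ω s) ENNReal.toReal_nonneg
    · simp only [tsum_mul_right, (p _).hasSum_toReal.tsum_eq]
      exact integrable_const _
  have hone : ∀ s ω, (X ⁻¹' {s}).indicator (fun _ => (1 : ℝ)) ω = if s = X ω then 1 else 0 :=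
    fun s ω => by simp [Set.indicator_apply, eq_comm]
  have h2 : HasSum (fun s => ∫ ω in B, g ω s * (X ⁻¹' {s}).indicator (fun _ => (1 : ℝ)) ω ∂μ)
      (∫ ω in B, g ω (X ω) ∂μ) := by
    refine hasSum_integral_of_dominated_convergence
      (fun s ω => C * (X ⁻¹' {s}).indicator (fun _ => (1 : ℝ)) ω)
      (fun s => (((hg s).mono hm le_rfl).mul
        (measurable_const.indicator (hXs s))).aestronglyMeasurable)
      (fun s => ae_of_all _ fun ω => ?_) (ae_of_all _ fun ω => ?_) ?_ (ae_of_all _ fun ω => ?_)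
    · rw [Real.norm_eq_abs, abs_mul, abs_of_nonneg (Set.indicator_nonneg (by simp) ω)]
      exact mul_le_mul_of_nonneg_right (hgC ω s) (Set.indicator_nonneg (by simp) ω)
    · simp only [hone, mul_ite, mul_one, mul_zero]
      exact (hasSum_ite_eq (X ω) C).summable
    · simp only [hone, mul_ite, mul_one, mul_zero, tsum_ite_eq]
      exact integrable_const _
    · simp only [hone, mul_ite, mul_one, mul_zero]
      rw [show (fun s => if s = X ω then g ω s else 0) = fun s => if s = X ω then g ω (X ω) else 0
        from funext fun s => by split_ifs with h <;> simp [h]]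
      exact hasSum_ite_eq (X ω) (g ω (X ω))
  -- Both integrals are split over the values `s` of `X`; they agree term by term, since the
  -- `m`-measurable factors `g · s` and `1_B` pull out of the conditional expectation.
  refine HasSum.unique ?_ h2
  convert h1 using 2 with s
  have hind : Integrable ((X ⁻¹' {s}).indicator fun _ => (1 : ℝ)) μ :=
    (integrable_const _).indicator (hXs s)
  have hpull := condExp_stronglyMeasurable_mul_of_bound hm (hg s).stronglyMeasurable hind C
    (ae_of_all μ fun ω => hgC ω s)
  have hi : Integrable ((fun ω => g ω s) * (X ⁻¹' {s}).indicator fun _ => (1 : ℝ)) μ :=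
    hind.bdd_mul ((hg s).mono hm le_rfl).aestronglyMeasurable (ae_of_all μ fun ω => hgC ω s)
  change ∫ ω in B, ((fun ω => g ω s) * (X ⁻¹' {s}).indicator fun _ => (1 : ℝ)) ω ∂μ = _
  rw [← setIntegral_condExp hm hi hB]
  refine setIntegral_congr_ae (hm B hB) ?_
  filter_upwards [hpull, hp s] with ω h3 h4 _
  rw [h3, Pi.mul_apply, h4, mul_comm]

variable [mΩ : MeasurableSpace Ω] {μ : Measure Ω} [IsProbabilityMeasure μ] {ℱ : Filtration ℕ mΩ}

/-- A martingale transform with bounded increments and square-summable, bounded coefficients. -/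
theorem ae_exists_tendsto_sum_mul_of_bound {c w : ℕ → Ω → ℝ} {K C : ℝ}
    (hc : ∀ t, Measurable[ℱ t] (c t)) (hw : ∀ t, Measurable[ℱ (t + 1)] (w t))
    (hwK : ∀ t, ∀ᵐ ω ∂μ, |w t ω| ≤ K) (hcond : ∀ t, μ[w t | ℱ t] =ᵐ[μ] 0)
    (hsq : ∀ ω n, ∑ t ∈ Finset.range n, c t ω ^ 2 ≤ C) :
    ∀ᵐ ω ∂μ, ∃ l, Tendsto (fun n => ∑ t ∈ Finset.range n, c t ω * w t ω) atTop (𝓝 l) := by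
  set f : ℕ → Ω → ℝ := fun n ω => ∑ t ∈ Finset.range n, c t ω * w t ω with hf
  have hC : 0 ≤ C := by
    obtain ⟨ω⟩ := μ.nonempty_of_neZero
    simpa using hsq ω 0
  have hcb : ∀ t ω, |c t ω| ≤ C + 1 := fun t ω => by
    have h1 : c t ω ^ 2 ≤ C := (Finset.single_le_sum (f := fun t => c t ω ^ 2)
      (fun i _ => sq_nonneg _) (Finset.self_mem_range_succ t)).trans (hsq ω (t + 1))
    nlinarith [sq_abs (c t ω), abs_nonneg (c t ω)]
  have hfm : ∀ n, Measurable[ℱ n] (f n) := fun n =>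
    Finset.measurable_fun_sum _ fun t ht =>
      ((hc t).mono (ℱ.mono (Finset.mem_range.1 ht).le) le_rfl).mul
        ((hw t).mono (ℱ.mono (Finset.mem_range.1 ht)) le_rfl)
  have hwint : ∀ t, Integrable (w t) μ := fun t =>
    Integrable.of_bound ((hw t).mono (ℱ.le _) le_rfl).aestronglyMeasurable K (hwK t)
  have hfb : ∀ n, ∃ D, ∀ᵐ ω ∂μ, |f n ω| ≤ D := fun n => by
    refine ⟨∑ t ∈ Finset.range n, (C + 1) * K, ?_⟩
    filter_upwards [ae_all_iff.2 hwK] with ω hω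
    refine (Finset.abs_sum_le_sum_abs _ _).trans (Finset.sum_le_sum fun t _ => ?_)
    rw [abs_mul]
    exact mul_le_mul (hcb t ω) (hω t) (abs_nonneg _) (by positivity)
  have hfint : ∀ n, Integrable (f n) μ := fun n => by
    obtain ⟨D, hD⟩ := hfb n
    exact Integrable.of_bound ((hfm n).mono (ℱ.le n) le_rfl).aestronglyMeasurable D hD
  have hpull : ∀ (n : ℕ) (g : Ω → ℝ) (D : ℝ), Measurable[ℱ n] g → (∀ᵐ ω ∂μ, |g ω| ≤ D) →
      μ[g * w n | ℱ n] =ᵐ[μ] 0 := fun n g D hg hD => by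
    filter_upwards [condExp_stronglyMeasurable_mul_of_bound (ℱ.le n) hg.stronglyMeasurable
      (hwint n) D hD, hcond n] with ω h1 h2
    rw [h1, Pi.mul_apply, h2, Pi.zero_apply, mul_zero]
  have hmart : Martingale f ℱ μ := by
    refine martingale_of_condExp_sub_eq_zero_nat (fun n => (hfm n).stronglyMeasurable) hfint
      fun n => ?_
    have e : f (n + 1) - f n = c n * w n := by
      funext ω
      simp [hf, Finset.sum_range_succ]
    rw [e]
    exact hpull n (c n) (C + 1) (hc n) (ae_of_all _ (hcb n))
  have hsqint : ∀ n, Integrable (fun ω => f n ω ^ 2) μ := fun n => by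
    obtain ⟨D, hD⟩ := hfb n
    refine Integrable.of_bound
      (((hfm n).pow_const 2).mono (ℱ.le n) le_rfl).aestronglyMeasurable (D ^ 2) ?_
    filter_upwards [hD] with ω hω
    rw [Real.norm_eq_abs, abs_pow]
    exact pow_le_pow_left₀ (abs_nonneg _) hω 2
  have hcsq : ∀ n, Integrable (fun ω => ∑ t ∈ Finset.range n, c t ω ^ 2) μ := fun n => by
    refine Integrable.of_bound (Finset.measurable_fun_sum _ fun t _ =>
      ((hc t).mono (ℱ.le t) le_rfl).pow_const 2).aestronglyMeasurable C (ae_of_all _ fun ω => ?_)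
    rw [Real.norm_eq_abs, abs_of_nonneg (Finset.sum_nonneg fun i _ => sq_nonneg _)]
    exact hsq ω n
  -- Orthogonality of martingale increments: the cross term integrates to zero, and each new square
  -- is at most `K ^ 2 * c n ^ 2`.
  have hvar : ∀ n, ∫ ω, f n ω ^ 2 ∂μ
      ≤ K ^ 2 * ∫ ω, ∑ t ∈ Finset.range n, c t ω ^ 2 ∂μ := by
    intro n
    induction n with
    | zero => simp [hf]
    | succ n ih =>
      obtain ⟨D, hD⟩ := hfb n
      have hgm : Measurable[ℱ n] (f n * c n) := (hfm n).mul (hc n)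
      have hgb : ∀ᵐ ω ∂μ, |(f n * c n) ω| ≤ D * (C + 1) := by
        filter_upwards [hD] with ω hω
        rw [Pi.mul_apply, abs_mul]
        exact mul_le_mul hω (hcb n ω) (abs_nonneg _) ((abs_nonneg _).trans hω)
      have hgi : Integrable (f n * c n * w n) μ :=
        (hwint n).bdd_mul (hgm.mono (ℱ.le n) le_rfl).aestronglyMeasurable hgb
      have hcross : ∫ ω, (f n * c n * w n) ω ∂μ = 0 := by
        rw [← integral_condExp (ℱ.le n), integral_congr_ae (hpull n _ _ hgm hgb)]
        simp
      have hcn : Integrable (fun ω => c n ω ^ 2) μ := by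
        refine ((hcsq (n + 1)).sub (hcsq n)).congr (ae_of_all _ fun ω => ?_)
        simp [Finset.sum_range_succ]
      have hle : ∫ ω, f (n + 1) ω ^ 2 ∂μ
          ≤ ∫ ω, (f n ω ^ 2 + 2 * (f n * c n * w n) ω + K ^ 2 * c n ω ^ 2) ∂μ := by
        refine integral_mono_ae (hsqint _)
          (((hsqint n).add (hgi.const_mul 2)).add (hcn.const_mul _)) ?_
        filter_upwards [hwK n] with ω hω
        have h1 : w n ω ^ 2 ≤ K ^ 2 := sq_le_sq' (abs_le.1 hω).1 (abs_le.1 hω).2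
        have h2 := mul_le_mul_of_nonneg_right h1 (sq_nonneg (c n ω))
        simp only [hf, Finset.sum_range_succ, Pi.mul_apply]
        nlinarith
      have heq : ∫ ω, (f n ω ^ 2 + 2 * (f n * c n * w n) ω + K ^ 2 * c n ω ^ 2) ∂μ
          = ∫ ω, f n ω ^ 2 ∂μ + K ^ 2 * ∫ ω, c n ω ^ 2 ∂μ := by
        rw [integral_add (f := fun ω => f n ω ^ 2 + 2 * (f n * c n * w n) ω)
          ((hsqint n).add (hgi.const_mul 2)) (hcn.const_mul _),
          integral_add (hsqint n) (hgi.const_mul 2), integral_const_mul, hcross,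
          integral_const_mul, mul_zero, add_zero]
      simp only [Finset.sum_range_succ]
      rw [integral_add (hcsq n) hcn]
      linarith
  -- `|x| ≤ 1 + x ^ 2` turns the second moment bound into the L¹ bound required by martingale
  -- convergence.
  have hL1 : ∀ n, eLpNorm (f n) 1 μ ≤ ((1 + K ^ 2 * C).toNNReal : ENNReal) := fun n => by
    rw [eLpNorm_one_eq_lintegral_enorm, ← ofReal_integral_norm_eq_lintegral_enorm (hfint n)]
    refine ENNReal.ofReal_le_ofReal ?_
    have h1 : ∫ ω, ‖f n ω‖ ∂μ ≤ ∫ ω, (1 + f n ω ^ 2) ∂μ :=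
      integral_mono (hfint n).norm ((integrable_const _).add (hsqint n)) fun ω => by
        have := sq_nonneg (|f n ω| - 1)
        simp only [Real.norm_eq_abs]
        nlinarith [sq_abs (f n ω), abs_nonneg (f n ω)]
    have h2 : ∫ ω, ∑ t ∈ Finset.range n, c t ω ^ 2 ∂μ ≤ C := by
      have := integral_mono (hcsq n) (integrable_const (μ := μ) C) fun ω => hsq ω n
      simpa using this
    rw [integral_add (integrable_const _) (hsqint n)] at h1
    simp only [integral_const, probReal_univ, smul_eq_mul, mul_one] at h1
    linarith [hvar n, mul_le_mul_of_nonneg_left h2 (sq_nonneg K)]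
  exact hmart.submartingale.exists_ae_tendsto_of_bdd hL1

/-- A martingale transform with bounded increments and almost surely square-summable
coefficients converges almost surely. -/
theorem ae_exists_tendsto_sum_mul {a w : ℕ → Ω → ℝ} {K : ℝ}
    (ha : ∀ t, Measurable[ℱ t] (a t)) (hw : ∀ t, Measurable[ℱ (t + 1)] (w t))
    (hwK : ∀ t, ∀ᵐ ω ∂μ, |w t ω| ≤ K) (hcond : ∀ t, μ[w t | ℱ t] =ᵐ[μ] 0)
    (hsq : ∀ᵐ ω ∂μ, Summable fun t => a t ω ^ 2) :
    ∀ᵐ ω ∂μ, ∃ l, Tendsto (fun n => ∑ t ∈ Finset.range n, a t ω * w t ω) atTop (𝓝 l) := by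
  -- Localization: coefficients are cut off once their sum of squares exceeds `C`. The sum includes
  -- index `t`, yet `E C t` is `ℱ t`-measurable because the coefficients are adapted.
  let E : ℕ → ℕ → Set Ω := fun C t => {ω | ∑ j ∈ Finset.range (t + 1), a j ω ^ 2 ≤ C}
  have hE : ∀ C t, MeasurableSet[ℱ t] (E C t) := fun C t =>
    measurableSet_le (Finset.measurable_fun_sum _ fun j hj =>
      ((ha j).mono (ℱ.mono (Nat.lt_succ_iff.1 (Finset.mem_range.1 hj))) le_rfl).pow_const 2)
      measurable_const
  have hb : ∀ (C : ℕ) ω n, ∑ t ∈ Finset.range n, (E C t).indicator (a t) ω ^ 2 ≤ C := by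
    intro C ω n
    induction n with
    | zero => simp
    | succ n ih =>
      by_cases h : ω ∈ E C n
      · refine (Finset.sum_le_sum fun t _ => ?_).trans h
        by_cases h' : ω ∈ E C t
        · rw [Set.indicator_of_mem h']
        · rw [Set.indicator_of_notMem h']
          simpa using sq_nonneg (a t ω)
      · rw [Finset.sum_range_succ, Set.indicator_of_notMem h]
        simpa using ih
  have hconv := ae_all_iff.2 fun C : ℕ => ae_exists_tendsto_sum_mul_of_bound (μ := μ)
    (fun t => (ha t).indicator (hE C t)) hw hwK hcond (hb C)
  filter_upwards [hconv, hsq] with ω h1 h2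
  -- For `C` above the total sum of squares, no coefficient is cut at this `ω`.
  obtain ⟨C, hC⟩ := exists_nat_ge (∑' t, a t ω ^ 2)
  have hmem : ∀ t, ω ∈ E C t := fun t =>
    (h2.sum_le_tsum _ fun _ _ => sq_nonneg _).trans hC
  simpa only [Set.indicator_of_mem (hmem _)] using h1 C

end Probability

/-! ### Smoothing errors and limits of averages. -/

lemma abs_sum_mul_sub_le {A : Type*} [Fintype A] {p f g : A → ℝ} (hp : p ∈ stdSimplex ℝ A) {c : ℝ}
    (h : ∀ a, |f a - g a| ≤ c) : |∑ a, p a * f a - ∑ a, p a * g a| ≤ c := by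
  rw [← Finset.sum_sub_distrib]
  calc |∑ a, (p a * f a - p a * g a)| ≤ ∑ a, p a * c :=
        (Finset.abs_sum_le_sum_abs _ _).trans (Finset.sum_le_sum fun a _ => by
          rw [← mul_sub, abs_mul, abs_of_nonneg (hp.1 a)]
          exact mul_le_mul_of_nonneg_left (h a) (hp.1 a))
    _ = c := by rw [← Finset.sum_mul, hp.2, one_mul]

/-- Maximizers contribute nothing to the difference, and every other action contributes at most `2 *
D` times its mass. -/
lemma abs_sum_mul_sub_ciSup_le {A : Type*} [Fintype A] [Nonempty A] {p f : A → ℝ}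
    (hp : p ∈ stdSimplex ℝ A) {D : ℝ} (hf : ∀ a, |f a| ≤ D) :
    |∑ a, p a * f a - ⨆ a, f a| ≤ 2 * D * (1 - actionMass p {a | ∀ b, f b ≤ f a}) := by
  have e1 : ∑ a, p a * f a - ⨆ a, f a = ∑ a, p a * (f a - ⨆ b, f b) := by
    simp only [mul_sub, Finset.sum_sub_distrib, ← Finset.sum_mul, hp.2, one_mul]
  have e2 : 2 * D * (1 - actionMass p {a | ∀ b, f b ≤ f a})
      = ∑ a, 2 * D * (p a - {a | ∀ b, f b ≤ f a}.indicator p a) := by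
    rw [← Finset.mul_sum, Finset.sum_sub_distrib, hp.2, actionMass]
  rw [e1, e2]
  refine (Finset.abs_sum_le_sum_abs _ _).trans (Finset.sum_le_sum fun a _ => ?_)
  rw [abs_mul, abs_of_nonneg (hp.1 a)]
  by_cases ha : a ∈ {a | ∀ b, f b ≤ f a}
  · have : ⨆ b, f b = f a :=
      le_antisymm (ciSup_le ha) (le_ciSup (Set.finite_range f).bddAbove a)
    simp [Set.indicator_of_mem ha, this]
  · rw [Set.indicator_of_notMem ha, sub_zero, mul_comm]
    refine mul_le_mul_of_nonneg_right ?_ (hp.1 a)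
    linarith [abs_sub (f a) (⨆ b, f b), hf a, abs_ciSup_le hf]

/-- The hypothesis is not uniform in `s`. The positive parts of `Y t s - c` tend to zero pointwise
and are bounded, so dominated convergence applies. -/
lemma PMF.eventually_mean_le {S : Type*} (p : PMF S) {Y : ℕ → S → ℝ} {D c : ℝ}
    (hD : ∀ t s, |Y t s| ≤ D) (h : ∀ s, ∀ δ > 0, ∀ᶠ t in atTop, Y t s ≤ c + δ) :
    ∀ δ > 0, ∀ᶠ t in atTop, p.mean (Y t) ≤ c + δ := by
  have hb : ∀ t s, |max (Y t s - c) 0| ≤ D + |c| := fun t s => by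
    have h1 := hD t s
    rw [abs_of_nonneg (le_max_right _ _)]
    refine max_le ?_ ?_
    · linarith [le_abs_self (Y t s), neg_abs_le c]
    · linarith [abs_nonneg (Y t s), abs_nonneg c]
  have hlim : Tendsto (fun t => p.mean fun s => max (Y t s - c) 0) atTop (𝓝 0) := by
    have : Tendsto (fun t => p.mean fun s => max (Y t s - c) 0) atTop
        (𝓝 (∑' _ : S, (0 : ℝ))) := by
      refine tendsto_tsum_of_dominated_convergence
        (p.hasSum_toReal.summable.mul_right (D + |c|)) (fun s => ?_)
        (Eventually.of_forall fun t s => ?_)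
      · have h0 : Tendsto (fun t => max (Y t s - c) 0) atTop (𝓝 0) := by
          refine Metric.tendsto_nhds.2 fun δ hδ => ?_
          filter_upwards [h s (δ / 2) (half_pos hδ)] with t ht
          rw [Real.dist_0_eq_abs, abs_of_nonneg (le_max_right _ _)]
          exact max_lt (by linarith) hδ
        simpa using h0.const_mul (p s).toReal
      · rw [Real.norm_eq_abs, abs_mul, abs_of_nonneg ENNReal.toReal_nonneg]
        exact mul_le_mul_of_nonneg_left (hb t s) ENNReal.toReal_nonneg
    simpa using this
  intro δ hδ
  filter_upwards [hlim.eventually_le_const hδ] with t ht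
  have hle : p.mean (Y t) ≤ p.mean fun s => c + max (Y t s - c) 0 :=
    p.mean_mono (hD t) (C := D) (D := |c| + (D + |c|))
      (fun s => (abs_add_le _ _).trans (add_le_add le_rfl (hb t s)))
      fun s => by linarith [le_max_left (Y t s - c) 0]
  rw [p.mean_add (fun _ => le_rfl) (hb t), p.mean_const] at hle
  linarith

lemma exists_tendsto_sum_noise {a n₁ n₂ n₃ : ℕ → ℝ} (b₁ b₂ b₃ : ℝ)
    (h₁ : ∃ l, Tendsto (fun n => ∑ t ∈ Finset.range n, a t * n₁ t) atTop (𝓝 l))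
    (h₂ : ∃ l, Tendsto (fun n => ∑ t ∈ Finset.range n, a t * n₂ t) atTop (𝓝 l))
    (h₃ : ∃ l, Tendsto (fun n => ∑ t ∈ Finset.range n, a t * n₃ t) atTop (𝓝 l)) :
    ∃ l, Tendsto (fun n => ∑ t ∈ Finset.range n, a t * (b₁ * n₁ t + b₂ * n₂ t + b₃ * n₃ t))
      atTop (𝓝 l) := by
  obtain ⟨l₁, h₁⟩ := h₁
  obtain ⟨l₂, h₂⟩ := h₂
  obtain ⟨l₃, h₃⟩ := h₃
  refine ⟨_, (((h₁.const_mul b₁).add (h₂.const_mul b₂)).add (h₃.const_mul b₃)).congr fun n => ?_⟩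
  simp only [Finset.mul_sum, ← Finset.sum_add_distrib]
  exact Finset.sum_congr rfl fun t _ => by ring

/-! ### Convergence along a single trajectory. -/

section Pathwise

variable {S A : Type*} [Fintype A] [Nonempty A] (M : MDP S A)
  {st : ℕ → S} {act : ℕ → A} {rew : ℕ → ℝ} {α : ℕ → S → A → ℝ} {q Q : ℕ → S → A → ℝ}

omit [Fintype A] [Nonempty A] in
lemma usedStep_mem_Icc (hα : ∀ t, α t (st t) (act t) ∈ Set.Icc (0 : ℝ) 1) (s : S) (a : A) (t : ℕ) :
    usedStep st act α s a t ∈ Set.Icc (0 : ℝ) 1 := by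
  by_cases h : st t = s ∧ act t = a
  · rw [usedStep, Set.indicator_of_mem (show t ∈ {k | st k = s ∧ act k = a} from h)]
    simpa only [h.1, h.2] using hα t
  · rw [usedStep, Set.indicator_of_notMem (show t ∉ {k | st k = s ∧ act k = a} from h)]
    simp

/-- Convergence of smoothed Q-learning along a trajectory on which the averaged noise converges
and the smoothed target is asymptotically within the current error of the optimal value. -/
theorem tendsto_optimalQ_of_trajectory {D : ℝ} {ε : ℕ → ℝ}
    (hbell : ∀ s a, M.bellman M.optimalQ s a = M.optimalQ s a)
    (hα : ∀ t, α t (st t) (act t) ∈ Set.Icc (0 : ℝ) 1)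
    (hαsum : ∀ s a, Tendsto (fun n => ∑ t ∈ Finset.range n, usedStep st act α s a t) atTop atTop)
    (hupd : ∀ t, Q (t + 1) (st t) (act t) = Q t (st t) (act t) + α t (st t) (act t) *
      (smoothedBellman M.discount (q t) (Q t) (rew t) (st (t + 1)) - Q t (st t) (act t)))
    (hkeep : ∀ t s a, (s, a) ≠ (st t, act t) → Q (t + 1) s a = Q t s a)
    (hD : ∀ t s a, |Q t s a - M.optimalQ s a| ≤ D)
    (hε : Tendsto ε atTop (𝓝 0))
    (hsmooth : ∀ t, |∑ a, q t (st (t + 1)) a * Q t (st (t + 1)) a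
        - ⨆ b, M.optimalQ (st (t + 1)) b|
      ≤ (⨆ b, |Q t (st (t + 1)) b - M.optimalQ (st (t + 1)) b|) + ε t)
    (hn₁ : ∀ s a, ∃ l, Tendsto (fun n => ∑ t ∈ Finset.range n, usedStep st act α s a t *
      (rew t - M.reward (st t) (act t))) atTop (𝓝 l))
    (hn₂ : ∀ s a, ∃ l, Tendsto (fun n => ∑ t ∈ Finset.range n, usedStep st act α s a t *
      ((⨆ b, M.optimalQ (st (t + 1)) b)
        - (M.trans (st t) (act t)).mean fun s' => ⨆ b, M.optimalQ s' b)) atTop (𝓝 l))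
    (hn₃ : ∀ s a, ∃ l, Tendsto (fun n => ∑ t ∈ Finset.range n, usedStep st act α s a t *
      ((⨆ b, |Q t (st (t + 1)) b - M.optimalQ (st (t + 1)) b|)
        - (M.trans (st t) (act t)).mean fun s' => ⨆ b, |Q t s' b - M.optimalQ s' b|))
      atTop (𝓝 l)) (s : S) (a : A) :
    Tendsto (fun t => Q t s a) atTop (𝓝 (M.optimalQ s a)) := by
  set Y : ℕ → S → ℝ := fun t s => ⨆ b, |Q t s b - M.optimalQ s b| with hY
  have hYD : ∀ t s, |Y t s| ≤ D := fun t s =>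
    abs_ciSup_le fun b => by rw [abs_abs]; exact hD t s b
  -- The signs `σ = 1` and `σ = -1` treat the two sides of `|Δ_t|`. The `Y` noise carries no `σ`,
  -- because it comes from the absolute error bound.
  have hstep : ∀ (σ : ℝ), |σ| = 1 → ∀ s a t, σ * (Q (t + 1) s a - M.optimalQ s a)
      ≤ (1 - usedStep st act α s a t) * (σ * (Q t s a - M.optimalQ s a))
        + usedStep st act α s a t * ((σ * (rew t - M.reward (st t) (act t))
          + σ * M.discount * ((⨆ b, M.optimalQ (st (t + 1)) b)
            - (M.trans (st t) (act t)).mean fun s' => ⨆ b, M.optimalQ s' b)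
          + M.discount * (Y t (st (t + 1)) - (M.trans (st t) (act t)).mean (Y t)))
          + M.discount * (ε t + (M.trans s a).mean (Y t))) := by
    intro σ hσ s a t
    by_cases h : st t = s ∧ act t = a
    · obtain ⟨rfl, rfl⟩ := h
      rw [usedStep, Set.indicator_of_mem
        (show t ∈ {k | st k = st t ∧ act k = act t} from ⟨rfl, rfl⟩), hupd, smoothedBellman]
      have h1 := hbell (st t) (act t)
      rw [MDP.bellman] at h1
      have h2 : σ * (∑ a, q t (st (t + 1)) a * Q t (st (t + 1)) a
          - ⨆ b, M.optimalQ (st (t + 1)) b) ≤ Y t (st (t + 1)) + ε t := by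
        refine (le_abs_self _).trans ?_
        rw [abs_mul, hσ, one_mul]
        exact hsmooth t
      have h3 := mul_le_mul_of_nonneg_left h2 (mul_nonneg (hα t).1 M.discount_pos.le)
      have h4 : α t (st t) (act t) * σ * (M.reward (st t) (act t) + M.discount *
          (M.trans (st t) (act t)).mean fun s' => ⨆ b, M.optimalQ s' b)
          = α t (st t) (act t) * σ * M.optimalQ (st t) (act t) := by rw [h1]
      linarith
    · rw [usedStep, Set.indicator_of_notMem (show t ∉ {k | st k = s ∧ act k = a} from h),
        hkeep t s a fun e => h ⟨(Prod.ext_iff.1 e).1.symm, (Prod.ext_iff.1 e).2.symm⟩]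
      simp
  -- The asymptotic contraction: a limsup bound `c` at all pairs improves to `γ c` at all pairs.
  have hcontract : ∀ c : ℝ,
      (∀ s a, ∀ δ > 0, ∀ᶠ t in atTop, |Q t s a - M.optimalQ s a| ≤ c + δ) →
      ∀ s a, ∀ δ > 0, ∀ᶠ t in atTop, |Q t s a - M.optimalQ s a| ≤ M.discount * c + δ := by
    intro c hc s a
    have hYc : ∀ s, ∀ δ > 0, ∀ᶠ t in atTop, Y t s ≤ c + δ := fun s δ hδ => by
      filter_upwards [eventually_all.2 fun b => hc s b δ hδ] with t ht
      exact ciSup_le ht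
    have hdrift : ∀ δ > 0, ∀ᶠ t in atTop,
        M.discount * (ε t + (M.trans s a).mean (Y t)) ≤ M.discount * c + δ := fun δ hδ => by
      filter_upwards [(M.trans s a).eventually_mean_le hYD hYc (δ / 2) (half_pos hδ),
        hε.eventually_le_const (half_pos hδ)] with t h1 h2
      have h3 := mul_le_mul_of_nonneg_left (add_le_add h2 h1) M.discount_pos.le
      nlinarith [M.discount_lt_one]
    have hside : ∀ σ : ℝ, |σ| = 1 → ∀ δ > 0, ∀ᶠ t in atTop,
        σ * (Q t s a - M.optimalQ s a) ≤ M.discount * c + δ := fun σ hσ => by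
      obtain ⟨l, hl⟩ := exists_tendsto_sum_noise σ (σ * M.discount) M.discount
        (hn₁ s a) (hn₂ s a) (hn₃ s a)
      exact eventually_le_of_noisy_recursion (usedStep_mem_Icc hα s a) (hαsum s a) hl
        (hstep σ hσ s a) hdrift
    intro δ hδ
    filter_upwards [hside 1 (by simp) δ hδ, hside (-1) (by simp) δ hδ] with t h1 h2
    exact abs_le.2 ⟨by linarith, by linarith⟩
  have hpow : ∀ k : ℕ, ∀ s a, ∀ δ > 0,
      ∀ᶠ t in atTop, |Q t s a - M.optimalQ s a| ≤ M.discount ^ k * D + δ := by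
    intro k
    induction k with
    | zero => exact fun s a δ hδ => Eventually.of_forall fun t => by linarith [hD t s a]
    | succ k ih =>
      rw [pow_succ', mul_assoc]
      exact hcontract _ ih
  refine Metric.tendsto_nhds.2 fun δ hδ => ?_
  have h0 : Tendsto (fun k => M.discount ^ k * D) atTop (𝓝 0) := by
    simpa using (tendsto_pow_atTop_nhds_zero_of_lt_one M.discount_pos.le
      M.discount_lt_one).mul_const D
  obtain ⟨k, hk⟩ := (h0.eventually_lt_const (half_pos hδ)).exists
  filter_upwards [hpow k s a (δ / 2) (half_pos hδ)] with t ht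
  rw [Real.dist_eq]
  linarith

omit [Nonempty A] in
/-- The iterates of smoothed Q-learning stay bounded. -/
lemma abs_iterate_le {R B : ℝ} (hq : ∀ t s, q t s ∈ stdSimplex ℝ A)
    (hα : ∀ t, α t (st t) (act t) ∈ Set.Icc (0 : ℝ) 1) (hrew : ∀ t, |rew t| ≤ R)
    (hupd : ∀ t, Q (t + 1) (st t) (act t) = Q t (st t) (act t) + α t (st t) (act t) *
      (smoothedBellman M.discount (q t) (Q t) (rew t) (st (t + 1)) - Q t (st t) (act t)))
    (hkeep : ∀ t s a, (s, a) ≠ (st t, act t) → Q (t + 1) s a = Q t s a)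
    (hB : R + M.discount * B ≤ B) (h0 : ∀ s a, |Q 0 s a| ≤ B) (t : ℕ) (s : S) (a : A) :
    |Q t s a| ≤ B := by
  induction t generalizing s a with
  | zero => exact h0 s a
  | succ t ih =>
    by_cases h : (s, a) = (st t, act t)
    · obtain ⟨rfl, rfl⟩ := Prod.ext_iff.1 h
      have h1 : |∑ b, q t (st (t + 1)) b * Q t (st (t + 1)) b| ≤ B := by
        simpa using abs_sum_mul_sub_le (hq t (st (t + 1))) (g := fun _ => 0)
          (f := Q t (st (t + 1))) (by simpa using ih (st (t + 1)))
      have h2 : |smoothedBellman M.discount (q t) (Q t) (rew t) (st (t + 1))| ≤ B := by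
        refine ((abs_add_le _ _).trans (add_le_add (hrew t) ?_)).trans hB
        rw [abs_mul, abs_of_pos M.discount_pos]
        exact mul_le_mul_of_nonneg_left h1 M.discount_pos.le
      obtain ⟨h3, h4⟩ := hα t
      have h5 := abs_le.1 (ih (st t) (act t))
      have h6 := abs_le.1 h2
      rw [hupd]
      exact abs_le.2 ⟨by nlinarith, by nlinarith⟩
    · rw [hkeep t s a h]
      exact ih s a

/-- The smoothed target approaches the optimal value up to the current error. -/
lemma exists_smoothing_error {B C : ℝ} {x : ℕ → S} (hq : ∀ t s, q t s ∈ stdSimplex ℝ A)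
    (hB : ∀ t s a, |Q t s a| ≤ B) (hC : ∀ s a, |M.optimalQ s a| ≤ C)
    (hmass : Tendsto (fun t => actionMass (q t (x t)) (greedyActions (Q t) (x t))) atTop (𝓝 1) ∨
      Tendsto (fun t => actionMass (q t (x t)) (greedyActions M.optimalQ (x t))) atTop (𝓝 1)) :
    ∃ ε : ℕ → ℝ, Tendsto ε atTop (𝓝 0) ∧ ∀ t,
      |∑ a, q t (x t) a * Q t (x t) a - ⨆ b, M.optimalQ (x t) b|
        ≤ (⨆ b, |Q t (x t) b - M.optimalQ (x t) b|) + ε t := by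
  have hle : ∀ t b, |Q t (x t) b - M.optimalQ (x t) b|
      ≤ ⨆ b, |Q t (x t) b - M.optimalQ (x t) b| := fun t b =>
    le_ciSup (f := fun b => |Q t (x t) b - M.optimalQ (x t) b|) (Set.finite_range _).bddAbove b
  rcases hmass with h | h
  -- Greedy for the iterate: compare the average with `max Q_t`, then `max Q_t` with `max Q*`.
  · refine ⟨fun t => 2 * B * (1 - actionMass (q t (x t)) (greedyActions (Q t) (x t))),
      by simpa using (h.const_sub 1).const_mul (2 * B), fun t => ?_⟩
    have h1 := abs_sum_mul_sub_ciSup_le (hq t (x t)) (hB t (x t))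
    have h2 := abs_ciSup_sub_ciSup_le (hle t)
    have h3 := abs_sub_le (∑ a, q t (x t) a * Q t (x t) a) (⨆ b, Q t (x t) b)
      (⨆ b, M.optimalQ (x t) b)
    simp only [greedyActions]
    linarith
  -- Greedy for `Q*`: replace `Q_t` by `Q*` under the same weights, then compare that average with
  -- `max Q*`.
  · refine ⟨fun t => 2 * C * (1 - actionMass (q t (x t)) (greedyActions M.optimalQ (x t))),
      by simpa using (h.const_sub 1).const_mul (2 * C), fun t => ?_⟩
    have h1 := abs_sum_mul_sub_ciSup_le (hq t (x t)) (hC (x t))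
    have h2 := abs_sum_mul_sub_le (hq t (x t)) (hle t)
    have h3 := abs_sub_le (∑ a, q t (x t) a * Q t (x t) a)
      (∑ a, q t (x t) a * M.optimalQ (x t) a) (⨆ b, M.optimalQ (x t) b)
    simp only [greedyActions]
    linarith

end Pathwise

/-! ### Adaptedness and the convergence of the noise sums. -/

lemma condExp_sub_ae_eq_zero {Ω : Type*} {m mΩ : MeasurableSpace Ω} {μ : Measure Ω}
    [IsFiniteMeasure μ] (hm : m ≤ mΩ) {f g : Ω → ℝ} (hf : Integrable f μ) (hg : Integrable g μ)
    (hgm : Measurable[m] g) (h : μ[f | m] =ᵐ[μ] g) : μ[f - g | m] =ᵐ[μ] 0 := by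
  filter_upwards [condExp_sub hf hg m, h] with ω h1 h2
  rw [h1, Pi.sub_apply, h2, condExp_of_stronglyMeasurable hm hgm.stronglyMeasurable hg, sub_self,
    Pi.zero_apply]

section Adapted

variable {S A Ω : Type*} [Countable S] [MeasurableSpace S] [MeasurableSingletonClass S]
  [Fintype A] [MeasurableSpace A] [MeasurableSingletonClass A]

lemma measurable_eval {m : MeasurableSpace Ω} {X : Ω → S} (hX : Measurable X) {g : Ω → S → ℝ}
    (hg : ∀ s, Measurable fun ω => g ω s) : Measurable fun ω => g ω (X ω) := by
  have : Measurable fun z : Ω × S => g z.1 z.2 := measurable_from_prod_countable_left hg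
  exact this.comp (measurable_id.prodMk hX)

lemma measurable_comp_pair {m : MeasurableSpace Ω} {X : Ω → S} {Z : Ω → A} (hX : Measurable X)
    (hZ : Measurable Z) (f : S → A → ℝ) : Measurable fun ω => f (X ω) (Z ω) :=
  (Measurable.of_discrete (f := fun x : S × A => f x.1 x.2)).comp (hX.prodMk hZ)

omit [MeasurableSpace A] [MeasurableSingletonClass A] in
lemma measurable_iSup_min_abs {m : MeasurableSpace Ω} {f : Ω → A → ℝ}
    (hf : ∀ a, Measurable fun ω => f ω a) (c : ℝ) :
    Measurable fun ω => ⨆ a, min |f ω a| c :=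
  Measurable.iSup fun a => (hf a).abs.min measurable_const

omit [Countable S] [Fintype A] in
lemma measurable_usedStep {m : MeasurableSpace Ω} {st : ℕ → Ω → S} {act : ℕ → Ω → A}
    {α : ℕ → Ω → S → A → ℝ} {t : ℕ} (hst : Measurable (st t)) (hact : Measurable (act t))
    (hα : ∀ s a, Measurable fun ω => α t ω s a) (s : S) (a : A) :
    Measurable fun ω =>
      usedStep (fun k => st k ω) (fun k => act k ω) (fun k => α k ω) s a t := by
  have e : (fun ω => usedStep (fun k => st k ω) (fun k => act k ω) (fun k => α k ω) s a t)
      = (st t ⁻¹' {s} ∩ act t ⁻¹' {a}).indicator fun ω => α t ω s a := by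
    rfl
  rw [e]
  exact (hα s a).indicator
    ((hst (measurableSet_singleton s)).inter (hact (measurableSet_singleton a)))

variable [mΩ : MeasurableSpace Ω] {μ : Measure Ω} [IsProbabilityMeasure μ] {ℱ : Filtration ℕ mΩ}
  (M : MDP S A) {st : ℕ → Ω → S} {act : ℕ → Ω → A} {rew : ℕ → Ω → ℝ}
  {α q Q : ℕ → Ω → S → A → ℝ}

omit [IsProbabilityMeasure μ] in
lemma measurable_iterate (hst : ∀ t, Measurable[ℱ t] (st t)) (hact : ∀ t, Measurable[ℱ t] (act t))
    (hrew : ∀ t, Measurable[ℱ (t + 1)] (rew t))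
    (hα : ∀ t s a, Measurable[ℱ t] fun ω => α t ω s a)
    (hq : ∀ t s a, Measurable[ℱ (t + 1)] fun ω => q t ω s a)
    (hQ0 : ∀ s a, Measurable[ℱ 0] fun ω => Q 0 ω s a)
    (hupd : ∀ t ω, Q (t + 1) ω (st t ω) (act t ω) = Q t ω (st t ω) (act t ω)
      + α t ω (st t ω) (act t ω) *
        (smoothedBellman M.discount (q t ω) (Q t ω) (rew t ω) (st (t + 1) ω)
          - Q t ω (st t ω) (act t ω)))
    (hkeep : ∀ t ω s a, (s, a) ≠ (st t ω, act t ω) → Q (t + 1) ω s a = Q t ω s a)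
    (t : ℕ) (s : S) (a : A) : Measurable[ℱ t] fun ω => Q t ω s a := by
  induction t generalizing s a with
  | zero => exact hQ0 s a
  | succ t ih =>
    have hle : ℱ t ≤ ℱ (t + 1) := ℱ.mono t.le_succ
    have ih' : ∀ s a, Measurable[ℱ (t + 1)] fun ω => Q t ω s a :=
      fun s a => (ih s a).mono hle le_rfl
    have hset : MeasurableSet[ℱ (t + 1)] (st t ⁻¹' {s} ∩ act t ⁻¹' {a}) :=
      hle _ ((hst t (measurableSet_singleton s)).inter (hact t (measurableSet_singleton a)))
    have htarget : Measurable[ℱ (t + 1)] fun ω =>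
        smoothedBellman M.discount (q t ω) (Q t ω) (rew t ω) (st (t + 1) ω) :=
      (hrew t).add ((Finset.measurable_fun_sum _ fun b _ =>
        (measurable_eval (hst (t + 1)) fun s => hq t s b).mul
          (measurable_eval (hst (t + 1)) fun s => ih' s b)).const_mul _)
    have e : (fun ω => Q (t + 1) ω s a) = fun ω => Q t ω s a
        + (st t ⁻¹' {s} ∩ act t ⁻¹' {a}).indicator (fun ω => α t ω s a *
          (smoothedBellman M.discount (q t ω) (Q t ω) (rew t ω) (st (t + 1) ω) - Q t ω s a)) ω := by
      funext ω
      by_cases h : st t ω = s ∧ act t ω = a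
      · rw [Set.indicator_of_mem (show ω ∈ st t ⁻¹' {s} ∩ act t ⁻¹' {a} from h)]
        obtain ⟨rfl, rfl⟩ := h
        exact hupd t ω
      · rw [Set.indicator_of_notMem (show ω ∉ st t ⁻¹' {s} ∩ act t ⁻¹' {a} from h), add_zero]
        exact hkeep t ω s a fun e => h ⟨(Prod.ext_iff.1 e).1.symm, (Prod.ext_iff.1 e).2.symm⟩
    rw [e]
    exact (ih' s a).add
      ((((hα t s a).mono hle le_rfl).mul (htarget.sub (ih' s a))).indicator hset)

/-- The sampling noise of a bounded adapted function of the next state averages out. -/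
lemma ae_exists_tendsto_sum_transition_noise
    (hst : ∀ t, Measurable[ℱ t] (st t)) (hact : ∀ t, Measurable[ℱ t] (act t))
    (htrans : ∀ t s', μ⟦st (t + 1) ⁻¹' {s'} | ℱ t⟧
      =ᵐ[μ] fun ω => (M.trans (st t ω) (act t ω) s').toReal)
    {a : ℕ → Ω → ℝ} (ha : ∀ t, Measurable[ℱ t] (a t))
    (hsq : ∀ᵐ ω ∂μ, Summable fun t => a t ω ^ 2) {g : ℕ → Ω → S → ℝ} {C : ℝ}
    (hg : ∀ t s, Measurable[ℱ t] fun ω => g t ω s) (hgC : ∀ t ω s, |g t ω s| ≤ C) :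
    ∀ᵐ ω ∂μ, ∃ l, Tendsto (fun n => ∑ t ∈ Finset.range n, a t ω *
      (g t ω (st (t + 1) ω) - (M.trans (st t ω) (act t ω)).mean (g t ω))) atTop (𝓝 l) := by
  have hpm : ∀ t s', Measurable[ℱ t] fun ω => (M.trans (st t ω) (act t ω) s').toReal :=
    fun t s' => measurable_comp_pair (hst t) (hact t) fun s a => (M.trans s a s').toReal
  have hmean : ∀ t, Measurable[ℱ t] fun ω => (M.trans (st t ω) (act t ω)).mean (g t ω) :=
    fun t => measurable_mean (hpm t) (hg t)
  have hnext : ∀ t, Measurable[ℱ (t + 1)] fun ω => g t ω (st (t + 1) ω) := fun t =>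
    measurable_eval (hst (t + 1)) fun s => (hg t s).mono (ℱ.mono t.le_succ) le_rfl
  refine ae_exists_tendsto_sum_mul (K := C + C) ha
    (fun t => (hnext t).sub ((hmean t).mono (ℱ.mono t.le_succ) le_rfl))
    (fun t => ae_of_all _ fun ω => (abs_sub _ _).trans
      (add_le_add (hgC t ω _) (PMF.abs_mean_le _ (hgC t ω)))) (fun t => ?_) hsq
  exact condExp_sub_ae_eq_zero (ℱ.le t)
    (Integrable.of_bound ((hnext t).mono (ℱ.le _) le_rfl).aestronglyMeasurable C
      (ae_of_all _ fun ω => hgC t ω _))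
    (Integrable.of_bound ((hmean t).mono (ℱ.le _) le_rfl).aestronglyMeasurable C
      (ae_of_all _ fun ω => PMF.abs_mean_le _ (hgC t ω))) (hmean t)
    (condExp_comp_eq_mean (ℱ.le t) ((hst (t + 1)).mono (ℱ.le _) le_rfl) (htrans t) (hpm t)
      (hg t) (hgC t))

/-- The noise of the observed rewards averages out. -/
lemma ae_exists_tendsto_sum_reward_noise {R : ℝ}
    (hst : ∀ t, Measurable[ℱ t] (st t)) (hact : ∀ t, Measurable[ℱ t] (act t))
    (hrew : ∀ t, Measurable[ℱ (t + 1)] (rew t))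
    (hmean : ∀ t, μ[rew t | ℱ t] =ᵐ[μ] fun ω => M.reward (st t ω) (act t ω))
    (hR : ∀ s a, |M.reward s a| ≤ R) (hrewR : ∀ᵐ ω ∂μ, ∀ t, |rew t ω| ≤ R)
    {a : ℕ → Ω → ℝ} (ha : ∀ t, Measurable[ℱ t] (a t))
    (hsq : ∀ᵐ ω ∂μ, Summable fun t => a t ω ^ 2) :
    ∀ᵐ ω ∂μ, ∃ l, Tendsto (fun n => ∑ t ∈ Finset.range n, a t ω *
      (rew t ω - M.reward (st t ω) (act t ω))) atTop (𝓝 l) := by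
  have hm : ∀ t, Measurable[ℱ t] fun ω => M.reward (st t ω) (act t ω) :=
    fun t => measurable_comp_pair (hst t) (hact t) M.reward
  have hrewR' := ae_all_iff.1 hrewR
  refine ae_exists_tendsto_sum_mul (K := R + R) ha
    (fun t => (hrew t).sub ((hm t).mono (ℱ.mono t.le_succ) le_rfl)) (fun t => ?_) (fun t => ?_) hsq
  · filter_upwards [hrewR' t] with ω hω
    exact (abs_sub _ _).trans (add_le_add hω (hR _ _))
  · exact condExp_sub_ae_eq_zero (ℱ.le t)
      (Integrable.of_bound ((hrew t).mono (ℱ.le _) le_rfl).aestronglyMeasurable R (hrewR' t))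
      (Integrable.of_bound ((hm t).mono (ℱ.le _) le_rfl).aestronglyMeasurable R
        (ae_of_all _ fun ω => hR _ _)) (hm t) (hmean t)

end Adapted

end

/-! ### Assembly of the convergence theorem. -/

theorem mainTheorem1 {S A Ω : Type*}
    [Countable S] [MeasurableSpace S] [MeasurableSingletonClass S]
    [Fintype A] [MeasurableSpace A] [MeasurableSingletonClass A]
    [MeasurableSpace Ω] (μ : Measure Ω) [IsProbabilityMeasure μ]
    (ℱ : Filtration ℕ (inferInstance : MeasurableSpace Ω))
    (M : MDP S A) (Rmax : ℝ)
    -- trajectory, observed rewards, step sizes, smoothing distributions, iterates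
    (st : ℕ → Ω → S) (act : ℕ → Ω → A) (rew : ℕ → Ω → ℝ)
    (α : ℕ → Ω → S → A → ℝ) (q : ℕ → Ω → S → A → ℝ) (Q : ℕ → Ω → S → A → ℝ)
    (hst : ∀ t, Measurable[ℱ t] (st t))
    (hact : ∀ t, Measurable[ℱ t] (act t))
    (hrew : ∀ t, Measurable[ℱ (t + 1)] (rew t))
    (hα : ∀ t s a, Measurable[ℱ t] fun ω => α t ω s a)
    (hq : ∀ t s a, Measurable[ℱ (t + 1)] fun ω => q t ω s a)
    -- the trajectory and the rewards are generated by the decision process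
    (htrans : ∀ t s', μ⟦st (t + 1) ⁻¹' {s'} | ℱ t⟧
      =ᵐ[μ] fun ω => (M.trans (st t ω) (act t ω) s').toReal)
    (hmean : ∀ t, μ[rew t | ℱ t] =ᵐ[μ] fun ω => M.reward (st t ω) (act t ω))
    -- bounded rewards
    (hR : ∀ s a, |M.reward s a| ≤ Rmax)
    (hrewR : ∀ᵐ ω ∂μ, ∀ t, |rew t ω| ≤ Rmax)
    -- Robbins-Monro step sizes
    (hα01 : ∀ᵐ ω ∂μ, ∀ t, α t ω (st t ω) (act t ω) ∈ Set.Icc (0 : ℝ) 1)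
    (hαsum : ∀ᵐ ω ∂μ, ∀ s a, Tendsto
      (fun n => ∑ t ∈ Finset.range n,
        usedStep (fun k => st k ω) (fun k => act k ω) (fun k => α k ω) s a t) atTop atTop)
    (hαsq : ∀ᵐ ω ∂μ, ∀ s a, Summable fun t =>
      usedStep (fun k => st k ω) (fun k => act k ω) (fun k => α k ω) s a t ^ 2)
    -- smoothing distributions
    (hqprob : ∀ t ω s, q t ω s ∈ stdSimplex ℝ A)
    -- smoothed Q-learning from a bounded initial value
    (hQ0meas : ∀ s a, Measurable[ℱ 0] fun ω => Q 0 ω s a)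
    (hQ0bdd : ∃ B : ℝ, ∀ ω s a, |Q 0 ω s a| ≤ B)
    (hQupdate : ∀ t ω, Q (t + 1) ω (st t ω) (act t ω) = Q t ω (st t ω) (act t ω)
      + α t ω (st t ω) (act t ω) *
        (smoothedBellman M.discount (q t ω) (Q t ω) (rew t ω) (st (t + 1) ω)
          - Q t ω (st t ω) (act t ω)))
    (hQkeep : ∀ t ω s a, (s, a) ≠ (st t ω, act t ω) → Q (t + 1) ω s a = Q t ω s a)
    -- asymptotically all mass is on greedy actions for the iterate, or on optimal actions
    (hmass : ∀ᵐ ω ∂μ,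
      Tendsto (fun t => actionMass (q t ω (st (t + 1) ω))
        (greedyActions (Q t ω) (st (t + 1) ω))) atTop (𝓝 1) ∨
      Tendsto (fun t => actionMass (q t ω (st (t + 1) ω))
        (greedyActions M.optimalQ (st (t + 1) ω))) atTop (𝓝 1)) :
    ∀ᵐ ω ∂μ, ∀ s a, Tendsto (fun t => Q t ω s a) atTop (𝓝 (M.optimalQ s a)) := by
  obtain ⟨ω₀⟩ := μ.nonempty_of_neZero
  have : Nonempty A := ⟨act 0 ω₀⟩
  obtain ⟨C, hC, hbell⟩ := M.optimalQ_bellman hR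
  obtain ⟨B₀, hB₀⟩ := hQ0bdd
  -- `Rmax / (1 - γ)` is the threshold above which `[-B, B]` is preserved by the update.
  set B : ℝ := max B₀ (Rmax / (1 - M.discount)) with hBdef
  have hB : Rmax + M.discount * B ≤ B := by
    have h1 : Rmax / (1 - M.discount) ≤ B := le_max_right _ _
    rw [div_le_iff₀ (sub_pos.2 M.discount_lt_one)] at h1
    linarith
  have hQm := measurable_iterate M hst hact hrew hα hq hQ0meas hQupdate hQkeep
  have hum := fun t s a => measurable_usedStep (hst t) (hact t) (hα t) s a
  have hsq := fun s a => hαsq.mono fun ω h => h s a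
  have hn₁ := ae_all_iff.2 fun s => ae_all_iff.2 fun a =>
    ae_exists_tendsto_sum_reward_noise M hst hact hrew hmean hR hrewR
      (fun t => hum t s a) (hsq s a)
  have hn₂ := ae_all_iff.2 fun s => ae_all_iff.2 fun a =>
    ae_exists_tendsto_sum_transition_noise M hst hact htrans (fun t => hum t s a) (hsq s a)
      (g := fun _ _ s' => ⨆ b, M.optimalQ s' b) (fun _ _ => measurable_const)
      fun _ _ s' => abs_ciSup_le (hC s')
  have hn₃ := ae_all_iff.2 fun s => ae_all_iff.2 fun a =>
    ae_exists_tendsto_sum_transition_noise M hst hact htrans (fun t => hum t s a) (hsq s a)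
      -- The noise lemma needs a bound at every `ω`, while the iterates are bounded only almost
      -- surely; the truncation supplies it and is inactive wherever `hD` holds.
      (g := fun t ω s' => ⨆ b, min |Q t ω s' b - M.optimalQ s' b| |B + C|)
      (fun t s' => measurable_iSup_min_abs (fun b => (hQm t s' b).sub_const _) _)
      fun t ω s' => abs_ciSup_le fun b => by
        rw [abs_of_nonneg (le_min (abs_nonneg _) (abs_nonneg _))]
        exact min_le_right _ _
  filter_upwards [hrewR, hα01, hαsum, hmass, hn₁, hn₂, hn₃] with ω hrω hαω hsω hmω h₁ h₂ h₃
  have hQB : ∀ t s a, |Q t ω s a| ≤ B :=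
    abs_iterate_le M (st := fun t => st t ω) (act := fun t => act t ω) (rew := fun t => rew t ω)
      (α := fun t => α t ω) (q := fun t => q t ω) (Q := fun t => Q t ω)
      (fun t => hqprob t ω) hαω hrω (fun t => hQupdate t ω) (fun t => hQkeep t ω) hB
      fun s a => (hB₀ ω s a).trans (le_max_left _ _)
  have hD : ∀ t s a, |Q t ω s a - M.optimalQ s a| ≤ |B + C| := fun t s a =>
    ((abs_sub _ _).trans (add_le_add (hQB t s a) (hC s a))).trans (le_abs_self _)
  simp only [fun t s a => min_eq_left (hD t s a)] at h₃
  obtain ⟨ε, hε, hsmooth⟩ := exists_smoothing_error M (q := fun t => q t ω)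
    (Q := fun t => Q t ω) (x := fun t => st (t + 1) ω) (fun t => hqprob t ω) hQB hC hmω
  exact tendsto_optimalQ_of_trajectory M (st := fun t => st t ω) (act := fun t => act t ω)
    (rew := fun t => rew t ω) (α := fun t => α t ω) (q := fun t => q t ω) (Q := fun t => Q t ω)
    hbell hαω hsω (fun t => hQupdate t ω) (fun t => hQkeep t ω) hD hε hsmooth h₁ h₂ h₃
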